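/- Consider an LTI plant $x_{k+1}=Ax_k+Bu_k+w_k$, $y_k=Cx_k+v_k$ ($y_k\in\mathbb R^p$), with the steady-state Kalman filter $\hat x_{k+1}=A\hat x_k+Bu_k+Kz_{k+1}$, residue $z_k=y_k-C(A\hat x_{k-1}+Bu_{k-1})$, $K=\Sigma C^T Q^{-1}$ and $Q=C\Sigma C^T+R\succ0$. Here $w_k\sim N(0,W)$ and $v_k\sim N(0,R)$; $\Sigma\succcurlyeq0$ is the steady-state one-step prediction error covariance, i.e. $\Sigma=A(\Sigma-KC\Sigma)A^T+W$; and $x_0-\hat x_0\sim N(0,\Sigma-KC\Sigma)$, $(w_k)_{k\ge0}$, $(v_k)_{k\ge1}$ are independent. In the attacked system the initial values and the noises are the same, the inputs may differ, and the measurements are $y^a_k=Cx^a_k+v_k+a_k$, where $(a_k)$ is a deterministic sequence with $a_0=0$ and every $a_k$ supported in a fixed nonempty set $\mathcal K$ of compromised sensors. Let $z_k^a$ be its residue and put $\Delta z_k=z_k^a-z_k$, which is deterministic. For the $\chi^2$ detector with threshold $h\in\mathbb R$ let $\beta_k=P(z_k^TQ^{-1}z_k>h)$ and $\beta_k^a=P((z^a_k)^TQ^{-1}z^a_k>h)$,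 and let $\|z\|_{Q^{-1}}=\|Q^{-1/2}z\|_2$. Theorem. Let $k\ge1$ and $0<\varepsilon<1-\beta_k$. Then there is a unique real $\alpha>0$ such that, for all attacks $a$, $$\beta_k^a\le\beta_k+\varepsilon\iff\|\Delta z_k\|_{Q^{-1}}\le\alpha .$$ Moreover $\alpha$ depends only on $\varepsilon$, $p$ and $h$. In the boundary case $0<\varepsilon=1-\beta_k$ the condition $\beta_k^a\le\beta_k+\varepsilon$ holds for every attack (that is, $\alpha=+\infty$). -/

import Mathlib

open MeasureTheory ProbabilityTheory
open scoped MatrixOrder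

noncomputable section

namespace StealthyAttack

/-- Euclidean space `ℝᵈ` (with the 2-norm). -/
abbrev Vec (d : ℕ) : Type := EuclideanSpace ℝ (Fin d)

/-- The matrix-vector product as a map between Euclidean spaces. -/
abbrev act {d e : ℕ} (M : Matrix (Fin e) (Fin d) ℝ) (x : Vec d) : Vec e :=
  Matrix.toEuclideanLin M x

/-- Weighted norm `‖z‖_{Q⁻¹} = ‖Q^{-1/2} z‖₂`, where `Q^{-1/2}` is the positive semidefinite
square root of `Q⁻¹`. -/
def invNorm {p : ℕ} (Q : Matrix (Fin p) (Fin p) ℝ) (z : Vec p) : ℝ :=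
  ‖act (CFC.sqrt Q⁻¹) z‖

/-- Data of an LTI plant `x_{k+1} = A x_k + B u_k + w_k`, `y_k = C x_k + v_k` together with the
covariances `W` of `w_k`, `R` of `v_k`, and the covariance `Sig` of the estimation error in the
Kalman gain. -/
structure LTISystem (n m p : ℕ) where
  A : Matrix (Fin n) (Fin n) ℝ
  B : Matrix (Fin n) (Fin m) ℝ
  C : Matrix (Fin p) (Fin n) ℝ
  W : Matrix (Fin n) (Fin n) ℝ
  R : Matrix (Fin p) (Fin p) ℝ
  Sig : Matrix (Fin n) (Fin n) ℝ

namespace LTISystem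

variable {n m p : ℕ} (S : LTISystem n m p)

/-- `Q = C Σ Cᵀ + R`. -/
def Q : Matrix (Fin p) (Fin p) ℝ := S.C * S.Sig * S.C.transpose + S.R

/-- Kalman gain `K = Σ Cᵀ (C Σ Cᵀ + R)⁻¹`. -/
def K : Matrix (Fin n) (Fin p) ℝ := S.Sig * S.C.transpose * S.Q⁻¹

/-- Covariance `Σ - K C Σ` of the error of the estimate after the measurement update, when `Σ` is
the covariance of the error before that update. -/
def postCov : Matrix (Fin n) (Fin n) ℝ := S.Sig - S.K * S.C * S.Sig

/-- `Σ` is the steady-state (one-step prediction) error covariance of the Kalman filter: it is a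
fixed point of the Riccati recursion. -/
structure IsSteadyState : Prop where
  posSemidef_W : S.W.PosSemidef
  posSemidef_R : S.R.PosSemidef
  posSemidef_Sig : S.Sig.PosSemidef
  posDef_Q : S.Q.PosDef
  riccati : S.Sig = S.A * S.postCov * S.A.transpose + S.W

/-- The plant state and the Kalman estimate `(x_k, x̂_k)` along one realization, from the initial
values, the inputs `u`, the noises `w`, `v`, and the signal `a` added to the measurements:
`x_{k+1} = A x_k + B u_k + w_k`, `y_{k+1} = C x_{k+1} + v_{k+1} + a_{k+1}`, and
`x̂_{k+1} = A x̂_k + B u_k + K (y_{k+1} - C (A x̂_k + B u_k))`. -/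
def traj (x₀ xh₀ : Vec n) (u : ℕ → Vec m) (w : ℕ → Vec n) (v a : ℕ → Vec p) :
    ℕ → Vec n × Vec n
  | 0 => (x₀, xh₀)
  | k + 1 =>
    let s := traj x₀ xh₀ u w v a k
    let x := act S.A s.1 + act S.B (u k) + w k
    let pred := act S.A s.2 + act S.B (u k)
    let y := act S.C x + v (k + 1) + a (k + 1)
    (x, pred + act S.K (y - act S.C pred))

/-- The residue `z_k = y_k - C (A x̂_{k-1} + B u_{k-1})` with `y_k = C x_k + v_k + a_k`, for
`k ≥ 1`. -/
def residue (x₀ xh₀ : Vec n) (u : ℕ → Vec m) (w : ℕ → Vec n) (v a : ℕ → Vec p) (k : ℕ) :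
    Vec p :=
  act S.C (S.traj x₀ xh₀ u w v a k).1 + v k + a k
    - act S.C (act S.A (S.traj x₀ xh₀ u w v a (k - 1)).2 + act S.B (u (k - 1)))

/-- The residue at time `k` as a random vector, for random initial values, inputs and noises and a
deterministic signal `a` added to the measurements (`a = 0` without attack). -/
def residueRV {Ω : Type*} (x₀ xh₀ : Ω → Vec n) (w : ℕ → Ω → Vec n) (v : ℕ → Ω → Vec p)
    (u : ℕ → Ω → Vec m) (a : ℕ → Vec p) (k : ℕ) (ω : Ω) : Vec p :=
  S.residue (x₀ ω) (xh₀ ω) (fun j => u j ω) (fun j => w j ω) (fun j => v j ω) a k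

/-- The `χ²` detection function `g = zᵀ Q⁻¹ z`. -/
def detector (z : Vec p) : ℝ := z.ofLp ⬝ᵥ (S.Q⁻¹).mulVec z.ofLp

/-- Probability of alarm `P(g > h)` for a random residue `z`. -/
def alarmProb {Ω : Type*} [MeasurableSpace Ω] (P : Measure Ω) (h : ℝ) (z : Ω → Vec p) : ℝ :=
  P.real {ω | h < S.detector (z ω)}

end LTISystem

/-- Labels of the independent sources of randomness: the initial estimation error, `w_k` for
`k ≥ 0`, and `v_{k+1}` for `k ≥ 0`. -/
inductive Source : Type
  | init : Source
  | process (k : ℕ) : Source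
  | sensor (k : ℕ) : Source

/-- Dimension of a source of randomness. -/
def Source.dim (n p : ℕ) : Source → ℕ
  | .init => n
  | .process _ => n
  | .sensor _ => p

/-- The random vector with a given label. -/
def Source.toFun {n p : ℕ} {Ω : Type*} (x₀ xh₀ : Ω → Vec n) (w : ℕ → Ω → Vec n)
    (v : ℕ → Ω → Vec p) : (s : Source) → Ω → Vec (s.dim n p)
  | .init => fun ω => x₀ ω - xh₀ ω
  | .process k => w k
  | .sensor k => v (k + 1)

/-- The stochastic assumptions: the initial estimation error and the noises are independent
zero-mean Gaussian vectors, and the filter is in steady state at time `0`. -/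
structure IsGaussianModel {n m p : ℕ} (S : LTISystem n m p) {Ω : Type*} [MeasurableSpace Ω]
    (P : Measure Ω) (x₀ xh₀ : Ω → Vec n) (w : ℕ → Ω → Vec n) (v : ℕ → Ω → Vec p) : Prop where
  law_init : HasLaw (fun ω => x₀ ω - xh₀ ω) (multivariateGaussian 0 S.postCov) P
  law_process : ∀ k, HasLaw (w k) (multivariateGaussian 0 S.W) P
  law_sensor : ∀ k, HasLaw (v (k + 1)) (multivariateGaussian 0 S.R) P
  indep : iIndepFun (fun s : Source => s.toFun x₀ xh₀ w v) P

/-- An attack signal on the sensors in `𝒦`: it starts at time `1` and is supported in `𝒦`. -/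
structure IsAttack {p : ℕ} (𝒦 : Finset (Fin p)) (a : ℕ → Vec p) : Prop where
  zero : a 0 = 0
  supp : ∀ k, ∀ i ∉ 𝒦, a k i = 0

/-- For all attacks on `𝒦`, the stealthiness condition `β_k^a ≤ β_k + ε` holds if and only if
`‖Δz_k‖_{Q⁻¹} ≤ α`, where `Δz_k = z_k^a - z_k`. The processes `u` and `ua a` are the inputs without
attack and under the attack `a`. As `Δz_k` does not depend on `ω`, the equivalence is stated at
every `ω`. -/
def StealthIffBound {n m p : ℕ} (S : LTISystem n m p) {Ω : Type*} [MeasurableSpace Ω]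
    (P : Measure Ω) (x₀ xh₀ : Ω → Vec n) (w : ℕ → Ω → Vec n) (v : ℕ → Ω → Vec p)
    (u : ℕ → Ω → Vec m) (ua : (ℕ → Vec p) → ℕ → Ω → Vec m) (𝒦 : Finset (Fin p))
    (h ε : ℝ) (k : ℕ) (α : ℝ) : Prop :=
  ∀ a : ℕ → Vec p, IsAttack 𝒦 a → ∀ ω : Ω,
    (S.alarmProb P h (S.residueRV x₀ xh₀ w v (ua a) a k)
        ≤ S.alarmProb P h (S.residueRV x₀ xh₀ w v u 0 k) + ε ↔
      invNorm S.Q (S.residueRV x₀ xh₀ w v (ua a) a k ω - S.residueRV x₀ xh₀ w v u 0 k ω) ≤ α)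

end StealthyAttack

end

/-! Inputs cancel in the estimation error, so by linearity the attacked residue is the attack-free
one plus a deterministic shift (`residueRV_succ`). In steady state the attack-free residue is N(0,
Q) (`hasLaw_innovation`). Whitening by Q^{-1/2} makes it standard Gaussian and turns the detector
into a squared norm, so the alarm probability is the tail P(‖x + c‖² > h), with c the whitened shift
(`alarmProb_eq`).

It remains to see that this tail stays below a level in (β, 1) exactly on a closed ball of centres
c. The tail is monotone in ‖c‖ by a reflection argument (`noncentralTail_mono`), continuous, and
above any level less than 1 once ‖c‖ is large. Strict monotonicity is not needed: the radius is a
supremum, and continuity settles the boundary (`noncentralTail_le_iff`). It involves only ε, p and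
h. Uniqueness of α holds because a one-time attack on a single compromised sensor realizes every
norm of c (`exists_attack_norm_eq`). -/

open scoped RealInnerProductSpace

/-! ### Tail of the noncentral χ² distribution as a function of the mean. -/

section NoncentralChiSquare

variable {E : Type*} [NormedAddCommGroup E] [InnerProductSpace ℝ E]

/-- The density of the standard Gaussian measure. -/
noncomputable def stdGaussianPDFReal (E : Type*) [NormedAddCommGroup E] [InnerProductSpace ℝ E]
    (x : E) : ℝ :=
  ((2 * Real.pi) ^ (Module.finrank ℝ E / 2 : ℝ))⁻¹ * Real.exp (-(1 / 2) * ‖x‖ ^ 2)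

lemma stdGaussianPDFReal_nonneg (x : E) : 0 ≤ stdGaussianPDFReal E x := by
  unfold stdGaussianPDFReal; positivity

lemma continuous_stdGaussianPDFReal : Continuous (stdGaussianPDFReal E) := by
  unfold stdGaussianPDFReal; fun_prop

lemma stdGaussianPDFReal_anti {x y : E} (h : ‖x‖ ≤ ‖y‖) :
    stdGaussianPDFReal E y ≤ stdGaussianPDFReal E x := by
  unfold stdGaussianPDFReal
  gcongr ?_ * Real.exp ?_
  nlinarith [norm_nonneg x]

variable [MeasurableSpace E] [BorelSpace E]

lemma measurable_ofReal_stdGaussianPDFReal :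
    Measurable (fun x : E => ENNReal.ofReal (stdGaussianPDFReal E x)) :=
  continuous_stdGaussianPDFReal.measurable.ennreal_ofReal

variable [FiniteDimensional ℝ E]

lemma integrable_stdGaussianPDFReal : Integrable (stdGaussianPDFReal E) := by
  refine Integrable.const_mul ?_ _
  have h := GaussianFourier.integrable_cexp_neg_mul_sq_norm_add (V := E) (b := 1 / 2)
    (by norm_num) 0 0
  convert h.norm using 2 with x
  simp [Complex.norm_exp, ← Complex.ofReal_pow]

/-- Equality of characteristic functions, by the Gaussian Fourier integral. Integrability of the
density supplies the finiteness that uniqueness requires. -/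
lemma stdGaussian_eq_withDensity :
    stdGaussian E = volume.withDensity (fun x => ENNReal.ofReal (stdGaussianPDFReal E x)) := by
  have : IsFiniteMeasure
      (volume.withDensity (fun x => ENNReal.ofReal (stdGaussianPDFReal E x))) :=
    isFiniteMeasure_withDensity_ofReal integrable_stdGaussianPDFReal.2
  apply Measure.ext_of_charFun
  ext t
  rw [charFun_stdGaussian, charFun_apply, integral_withDensity_eq_integral_toReal_smul
    measurable_ofReal_stdGaussianPDFReal (by simp)]
  have h := GaussianFourier.integral_cexp_neg_mul_sq_norm_add (V := E) (b := 1 / 2)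
    (by norm_num) Complex.I t
  have hc : ((Real.pi : ℂ) / (1 / 2)) ^ (Module.finrank ℝ E / 2 : ℂ) =
      (((2 * Real.pi) ^ (Module.finrank ℝ E / 2 : ℝ) : ℝ) : ℂ) := by
    rw [Complex.ofReal_cpow (by positivity)]
    push_cast
    congr 1
    ring
  have hpos : (((2 * Real.pi) ^ (Module.finrank ℝ E / 2 : ℝ) : ℝ) : ℂ) ≠ 0 := by
    have : (0 : ℝ) < (2 * Real.pi) ^ (Module.finrank ℝ E / 2 : ℝ) := by positivity
    exact_mod_cast this.ne'
  rw [hc] at h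
  calc Complex.exp (-‖t‖ ^ 2 / 2)
      = (((2 * Real.pi) ^ (Module.finrank ℝ E / 2 : ℝ) : ℝ) : ℂ)⁻¹ *
        ∫ v : E, Complex.exp (-(1 / 2) * ‖v‖ ^ 2 + Complex.I * ⟪t, v⟫) := by
        rw [h, ← mul_assoc, inv_mul_cancel₀ hpos, one_mul, Complex.I_sq]
        congr 1
        ring
    _ = _ := by
        rw [← integral_const_mul]
        congr 1
        ext x
        rw [ENNReal.toReal_ofReal (stdGaussianPDFReal_nonneg x), stdGaussianPDFReal,
          Complex.real_smul, Complex.exp_add, real_inner_comm]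
        push_cast
        ring_nf

lemma stdGaussian_absolutelyContinuous : stdGaussian E ≪ volume := by
  rw [stdGaussian_eq_withDensity]
  exact withDensity_absolutelyContinuous _ _

/-- The probability that the squared norm of a Gaussian vector with mean `c` and identity covariance
exceeds `h`, i.e. the tail function of the noncentral `χ²` distribution. -/
noncomputable def noncentralTail (h : ℝ) (c : E) : ℝ :=
  (stdGaussian E).real {x | h < ‖x + c‖ ^ 2}

lemma measurableSet_lt_norm_add_sq {E : Type*} [NormedAddCommGroup E] [MeasurableSpace E]
    [BorelSpace E] (h : ℝ) (c : E) : MeasurableSet {x : E | h < ‖x + c‖ ^ 2} :=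
  (isOpen_lt continuous_const (by fun_prop)).measurableSet

/-- Reflections that swap the centres of two spheres compare the Gaussian measures of their
exteriors. -/
lemma noncentralTail_mono {h : ℝ} {c d : E} (hcd : ‖c‖ ≤ ‖d‖) :
    noncentralTail h c ≤ noncentralTail h d := by
  set U : E → Set E := fun c => {x | h < ‖x + c‖ ^ 2} with hU
  have hUm : ∀ c, MeasurableSet (U c) := measurableSet_lt_norm_add_sq h
  set R : E ≃ₗᵢ[ℝ] E := (Submodule.span ℝ {d - c})ᗮ.reflection with hR
  -- The affine reflection exchanging the centres -c and -d. A point of `U c \ U d` is nearer to -d,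
  -- while the origin is at least as near to -c, so reflecting cannot increase the norm.
  set ρ : E → E := fun x => R (x + c) - d with hρ
  have hRn : R (d - c) = -(d - c) := Submodule.reflection_orthogonalComplement_singleton_eq_neg _
  have hρm : MeasurePreserving ρ volume volume :=
    (measurePreserving_sub_right volume d).comp
      (R.measurePreserving.comp (measurePreserving_add_right volume c))
  have h1 : ∀ x, ‖ρ x + d‖ = ‖x + c‖ := fun x => by
    simp only [hρ, sub_add_cancel, R.norm_map]
  have h2 : ∀ x, ‖ρ x + c‖ = ‖x + d‖ := fun x => by
    have : ρ x + c = R (x + d) := by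
      have : x + d = (x + c) + (d - c) := by abel
      rw [this, map_add, hRn]
      simp only [hρ]
      abel
    rw [this, R.norm_map]
  have hpre : ρ ⁻¹' (U d \ U c) = U c \ U d := by
    ext x
    simp [hU, h1, h2]
  have hnorm : ∀ x ∈ U c \ U d, ‖ρ x‖ ≤ ‖x‖ := by
    intro x hx
    have hlt : ‖x + d‖ ^ 2 < ‖x + c‖ ^ 2 := lt_of_le_of_lt (not_lt.1 hx.2) hx.1
    set n := d - c with hn
    have hn0 : n ≠ 0 := by
      intro h0
      rw [sub_eq_zero.1 h0] at hlt
      exact lt_irrefl _ hlt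
    have hnn : 0 < ‖n‖ ^ 2 := by positivity
    set s := ⟪n, x + c⟫ / ‖n‖ ^ 2 with hs
    have hsn : s * ‖n‖ ^ 2 = ⟪n, x + c⟫ := by rw [hs]; field_simp
    have hRx : R (x + c) = (x + c) - (2 * s) • n := by
      rw [hR, Submodule.reflection_orthogonal_apply, Submodule.reflection_singleton_apply]
      simp only [hs, RCLike.ofReal_real_eq_id, id_eq]
      rw [two_smul, ← add_smul]
      rw [neg_sub, ← two_mul]
    have hρx : ρ x = x - (2 * s + 1) • n := by
      simp only [hρ]
      rw [hRx, add_smul, one_smul, hn]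
      abel
    have hd : d = c + n := by rw [hn]; abel
    rw [hd] at hlt hcd
    have e1 : ‖x + (c + n)‖ ^ 2 = ‖x + c‖ ^ 2 + 2 * ⟪n, x + c⟫ + ‖n‖ ^ 2 := by
      rw [← add_assoc, norm_add_sq_real, real_inner_comm]
    have e2 : ‖c + n‖ ^ 2 = ‖c‖ ^ 2 + 2 * ⟪n, c⟫ + ‖n‖ ^ 2 := by
      rw [norm_add_sq_real, real_inner_comm]
    have e3 : ‖c‖ ^ 2 ≤ ‖c + n‖ ^ 2 := by gcongr
    have e4 : ‖ρ x‖ ^ 2 = ‖x‖ ^ 2 - 2 * (2 * s + 1) * ⟪n, x⟫ + (2 * s + 1) ^ 2 * ‖n‖ ^ 2 := by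
      rw [hρx, norm_sub_sq_real, inner_smul_right, norm_smul, mul_pow, real_inner_comm,
        Real.norm_eq_abs, sq_abs]
      ring
    rw [e1, ← hsn] at hlt
    rw [e2] at e3
    rw [inner_add_right] at hsn
    have hs1 : 2 * s + 1 < 0 := by
      by_contra hcon
      have := mul_nonneg (not_lt.1 hcon) hnn.le
      linarith
    -- The second factor is ‖d‖² - ‖c‖², and the product is exactly the drop ‖x‖² - ‖ρ x‖².
    have key : 0 ≤ (-(2 * s + 1)) * (2 * ⟪n, c⟫ + ‖n‖ ^ 2) := mul_nonneg (by linarith) (by linarith)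
    have e5 : ‖ρ x‖ ^ 2 = ‖x‖ ^ 2 - (-(2 * s + 1)) * (2 * ⟪n, c⟫ + ‖n‖ ^ 2) := by
      rw [e4]
      linear_combination 2 * (2 * s + 1) * hsn
    exact (sq_le_sq₀ (norm_nonneg _) (norm_nonneg _)).1 (by linarith)
  have hdiff : stdGaussian E (U c \ U d) ≤ stdGaussian E (U d \ U c) := by
    rw [stdGaussian_eq_withDensity, withDensity_apply _ ((hUm c).diff (hUm d)),
      withDensity_apply _ ((hUm d).diff (hUm c)),
      ← hρm.setLIntegral_comp_preimage ((hUm d).diff (hUm c)) measurable_ofReal_stdGaussianPDFReal,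
      hpre]
    exact setLIntegral_mono' ((hUm c).diff (hUm d)) fun x hx =>
      ENNReal.ofReal_le_ofReal (stdGaussianPDFReal_anti (hnorm x hx))
  change (stdGaussian E).real (U c) ≤ (stdGaussian E).real (U d)
  -- The common part `U c ∩ U d` cancels, leaving only the two differences to compare.
  rw [← measureReal_inter_add_sdiff (s := U c) (hUm d),
    ← measureReal_inter_add_sdiff (s := U d) (hUm c),
    Set.inter_comm (U d)]
  exact add_le_add le_rfl (ENNReal.toReal_mono (measure_ne_top _ _) hdiff)

lemma stdGaussian_norm_add_sq_eq [Nontrivial E] (h : ℝ) (c : E) :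
    stdGaussian E {x | ‖x + c‖ ^ 2 = h} = 0 := by
  refine stdGaussian_absolutelyContinuous (measure_mono_null ?_
    (Measure.addHaar_sphere volume (-c) (Real.sqrt h)))
  intro x hx
  rw [mem_sphere_iff_norm, sub_neg_eq_add, ← (show _ = h from hx), Real.sqrt_sq (norm_nonneg _)]

/-- Dominated convergence: for x off the null sphere ‖x + c‖² = h, the indicator is locally constant
in the centre. Nontriviality makes the sphere null even when it is a point. -/
lemma continuous_noncentralTail [Nontrivial E] (h : ℝ) :
    Continuous (noncentralTail (E := E) h) := by
  have heq : noncentralTail (E := E) h = fun c => ∫ x, Set.indicator {x : E | h < ‖x + c‖ ^ 2}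
      (fun _ => (1 : ℝ)) x ∂stdGaussian E := by
    ext c
    rw [integral_indicator_const _ (measurableSet_lt_norm_add_sq h c)]
    simp [noncentralTail]
  rw [heq, continuous_iff_continuousAt]
  intro c
  refine continuousAt_of_dominated (bound := fun _ => 1) ?_ ?_ (integrable_const _) ?_
  · exact .of_forall fun d => (measurable_const.indicator
      (measurableSet_lt_norm_add_sq h d)).aestronglyMeasurable
  · exact .of_forall fun d => .of_forall fun x => by
      rw [Set.indicator_apply]
      split_ifs <;> simp
  · have hae : ∀ᵐ x ∂stdGaussian E, ‖x + c‖ ^ 2 ≠ h := by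
      rw [ae_iff]
      simpa using stdGaussian_norm_add_sq_eq h c
    filter_upwards [hae] with x hx
    have hcont : ContinuousAt (fun d => ‖x + d‖ ^ 2) c := by fun_prop
    rcases lt_or_gt_of_ne hx with hlt | hlt
    · refine continuousAt_const.congr (f := fun _ => (0 : ℝ)) ?_
      filter_upwards [hcont.eventually_lt_const hlt] with d hd
      simp [hd.le]
    · refine continuousAt_const.congr (f := fun _ => (1 : ℝ)) ?_
      filter_upwards [hcont.eventually_const_lt hlt] with d hd
      simp [hd]

/-- Some ball about 0 has Gaussian mass above b, and a far enough centre puts all of it in the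
exceedance region. -/
lemma exists_norm_bound_of_noncentralTail_le (h : ℝ) {b : ℝ} (hb : b < 1) :
    ∃ r : ℝ, ∀ c : E, noncentralTail h c ≤ b → ‖c‖ ≤ r := by
  have ht : Filter.Tendsto (fun n : ℕ => (stdGaussian E).real (Metric.closedBall 0 n))
      Filter.atTop (nhds 1) := by
    have := tendsto_measure_iUnion_atTop (μ := stdGaussian E)
      (s := fun n : ℕ => Metric.closedBall (0 : E) n)
      (fun i j hij => Metric.closedBall_subset_closedBall (by exact_mod_cast hij))
    rw [Metric.iUnion_closedBall_nat, measure_univ] at this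
    exact (ENNReal.tendsto_toReal ENNReal.one_ne_top).comp this
  obtain ⟨n, hn⟩ := (ht.eventually_const_lt hb).exists
  refine ⟨n + Real.sqrt |h|, fun c hc => ?_⟩
  by_contra! hcon
  refine absurd (hn.trans_le ?_) (not_lt.2 hc)
  refine measureReal_mono fun x hx => ?_
  rw [mem_closedBall_zero_iff] at hx
  have h1 : ‖c‖ ≤ ‖x + c‖ + ‖x‖ := by
    simpa using norm_sub_le (x + c) x
  have h2 : Real.sqrt |h| < ‖x + c‖ := by linarith
  calc h ≤ |h| := le_abs_self h
    _ < ‖x + c‖ ^ 2 := (Real.sqrt_lt' ((Real.sqrt_nonneg _).trans_lt h2)).1 h2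

/-- The largest norm of a mean vector that raises the tail function of the `χ²` distribution by at
most `ε`. -/
noncomputable def noncentralRadius (E : Type*) [NormedAddCommGroup E] [InnerProductSpace ℝ E]
    [FiniteDimensional ℝ E] [MeasurableSpace E] (ε h : ℝ) : ℝ :=
  sSup {r | ∃ c : E, ‖c‖ = r ∧ noncentralTail h c ≤ noncentralTail h (0 : E) + ε}

section Radius

variable {ε h : ℝ}

lemma bddAbove_noncentralRadius (hε : ε < 1 - noncentralTail h (0 : E)) :
    BddAbove {r | ∃ c : E, ‖c‖ = r ∧ noncentralTail h c ≤ noncentralTail h (0 : E) + ε} := by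
  obtain ⟨r, hr⟩ := exists_norm_bound_of_noncentralTail_le (E := E) h
    (b := noncentralTail h (0 : E) + ε) (by linarith)
  exact ⟨r, by rintro _ ⟨c, rfl, hc⟩; exact hr c hc⟩

variable [Nontrivial E]

lemma noncentralRadius_pos (hε0 : 0 < ε) (hε : ε < 1 - noncentralTail h (0 : E)) :
    0 < noncentralRadius E ε h := by
  have hev : ∀ᶠ c in nhds (0 : E), noncentralTail h c < noncentralTail h (0 : E) + ε :=
    (continuous_noncentralTail h).continuousAt.eventually_lt_const (by linarith)
  obtain ⟨δ, hδ, hball⟩ := Metric.eventually_nhds_iff.1 hev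
  obtain ⟨c, hc⟩ := exists_norm_eq E (half_pos hδ).le
  refine (half_pos hδ).trans_le (le_csSup (bddAbove_noncentralRadius hε) ⟨c, hc, (hball ?_).le⟩)
  rw [dist_zero_right, hc]
  exact half_lt_self hδ

lemma noncentralTail_le_iff (hε0 : 0 < ε) (hε : ε < 1 - noncentralTail h (0 : E)) (c : E) :
    noncentralTail h c ≤ noncentralTail h (0 : E) + ε ↔ ‖c‖ ≤ noncentralRadius E ε h := by
  refine ⟨fun hc => le_csSup (bddAbove_noncentralRadius hε) ⟨c, rfl, hc⟩, fun hc => ?_⟩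
  have hlt : ∀ d : E, ‖d‖ < noncentralRadius E ε h →
      noncentralTail h d ≤ noncentralTail h (0 : E) + ε := by
    intro d hd
    have hne : {r | ∃ c : E, ‖c‖ = r ∧
        noncentralTail h c ≤ noncentralTail h (0 : E) + ε}.Nonempty := ⟨_, 0, rfl, by linarith⟩
    obtain ⟨_, ⟨e, rfl, he⟩, hde⟩ := exists_lt_of_lt_csSup hne hd
    exact (noncentralTail_mono hde.le).trans he
  -- The case ‖c‖ = radius is reached from inside the ball along t • c, t ↑ 1.
  have htend : Filter.Tendsto (fun t : ℝ => noncentralTail h (t • c)) (nhdsWithin 1 (Set.Iio 1))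
      (nhds (noncentralTail h c)) := by
    have : Continuous fun t : ℝ => noncentralTail h (t • c) :=
      (continuous_noncentralTail h).comp (by fun_prop)
    simpa using (this.tendsto 1).mono_left nhdsWithin_le_nhds
  refine le_of_tendsto htend ?_
  filter_upwards [Ioo_mem_nhdsLT (zero_lt_one' ℝ)] with t ht
  refine hlt _ ?_
  rw [norm_smul, Real.norm_of_nonneg ht.1.le]
  have := noncentralRadius_pos hε0 hε
  nlinarith [ht.1, ht.2, norm_nonneg c]

end Radius

end NoncentralChiSquare

noncomputable section

namespace StealthyAttack

/-! ### Linear images and independent sums of Gaussian vectors. -/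

section Gaussian

variable {d e : ℕ} {Ω : Type*} [MeasurableSpace Ω] {P : Measure Ω}

lemma act_mul {f : ℕ} (M : Matrix (Fin f) (Fin e) ℝ) (N : Matrix (Fin e) (Fin d) ℝ) (x : Vec d) :
    act (M * N) x = act M (act N x) := by
  ext i
  simp [act]

lemma act_one (x : Vec d) : act 1 x = x := by
  ext i
  simp [act]

lemma act_zero (M : Matrix (Fin e) (Fin d) ℝ) : act M 0 = 0 :=
  map_zero _

lemma act_smul (M : Matrix (Fin e) (Fin d) ℝ) (r : ℝ) (x : Vec d) :
    act M (r • x) = r • act M x :=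
  map_smul _ _ _

lemma act_sub_left (M N : Matrix (Fin e) (Fin d) ℝ) (x : Vec d) :
    act (M - N) x = act M x - act N x := by
  simp [act]

lemma continuous_act (M : Matrix (Fin e) (Fin d) ℝ) : Continuous (act M) :=
  LinearMap.continuous_of_finiteDimensional _

lemma measurable_act (M : Matrix (Fin e) (Fin d) ℝ) : Measurable (act M) :=
  (continuous_act M).measurable

lemma inner_act (M : Matrix (Fin e) (Fin d) ℝ) (x : Vec d) (y : Vec e) :
    ⟪act M x, y⟫ = ⟪x, act M.transpose y⟫ := by
  simp only [EuclideanSpace.inner_eq_star_dotProduct, act, Matrix.ofLp_toLpLin, Matrix.toLin'_apply,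
    star_trivial]
  rw [Matrix.dotProduct_mulVec, Matrix.mulVec_transpose, dotProduct_comm]

lemma hasLaw_act {X : Ω → Vec d} {T : Matrix (Fin d) (Fin d) ℝ} (hT : T.PosSemidef)
    (hX : HasLaw X (multivariateGaussian 0 T) P) (M : Matrix (Fin e) (Fin d) ℝ) :
    HasLaw (fun ω => act M (X ω)) (multivariateGaussian 0 (M * T * M.transpose)) P := by
  have hm : AEMeasurable (fun ω => act M (X ω)) P :=
    (measurable_act M).comp_aemeasurable hX.aemeasurable
  have := hX.isProbabilityMeasure
  have hMT : (M * T * M.transpose).PosSemidef := by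
    simpa using hT.mul_mul_conjTranspose_same M
  refine ⟨hm, ?_⟩
  have := Measure.isProbabilityMeasure_map hm
  apply Measure.ext_of_charFun
  ext t
  rw [charFun_multivariateGaussian hMT, charFun_apply, integral_map hm (by fun_prop)]
  have h1 := congrFun (congrArg charFun hX.map_eq) (act M.transpose t)
  rw [charFun_multivariateGaussian hT, charFun_apply,
    integral_map hX.aemeasurable (by fun_prop)] at h1
  simp_rw [inner_act, h1]
  simp only [inner_zero_right, act, Matrix.ofLp_toLpLin, Matrix.toLin'_apply]
  congr 4
  rw [← Matrix.mulVec_mulVec, ← Matrix.mulVec_mulVec, Matrix.dotProduct_mulVec t.ofLp M,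
    Matrix.mulVec_transpose]

lemma hasLaw_add {X Y : Ω → Vec d} {T T' : Matrix (Fin d) (Fin d) ℝ} (hT : T.PosSemidef)
    (hT' : T'.PosSemidef) (hX : HasLaw X (multivariateGaussian 0 T) P)
    (hY : HasLaw Y (multivariateGaussian 0 T') P) (hXY : IndepFun X Y P) :
    HasLaw (fun ω => X ω + Y ω) (multivariateGaussian 0 (T + T')) P := by
  have hm : AEMeasurable (fun ω => X ω + Y ω) P := hX.aemeasurable.add hY.aemeasurable
  have := hX.isProbabilityMeasure
  refine ⟨hm, ?_⟩
  have := Measure.isProbabilityMeasure_map hm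
  apply Measure.ext_of_charFun
  rw [hXY.charFun_map_fun_add_eq_mul hX.aemeasurable hY.aemeasurable, hX.map_eq, hY.map_eq]
  ext t
  rw [Pi.mul_apply, charFun_multivariateGaussian hT, charFun_multivariateGaussian hT',
    charFun_multivariateGaussian (hT.add hT'), ← Complex.exp_add]
  congr 1
  simp only [inner_zero_right, Matrix.add_mulVec, dotProduct_add]
  push_cast
  ring

end Gaussian

/-! ### Error dynamics, the attack's contribution, and the law of the innovation. -/

namespace LTISystem

variable {n m p : ℕ} (S : LTISystem n m p)

/-- The covariance after the measurement update in Joseph form. -/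
lemma IsSteadyState.postCov_eq {S : LTISystem n m p} (hS : S.IsSteadyState) :
    S.postCov = (1 - S.K * S.C) * S.Sig * (1 - S.K * S.C).transpose
      + S.K * S.R * S.K.transpose := by
  have hdet : IsUnit S.Q.det := hS.posDef_Q.det_pos.ne'.isUnit
  have hSig : S.Sig.transpose = S.Sig := by
    simpa using hS.posSemidef_Sig.isHermitian.eq
  have hKQ : S.K * S.Q = S.Sig * S.C.transpose := by
    rw [K, Matrix.mul_assoc, Matrix.nonsing_inv_mul _ hdet, Matrix.mul_one]
  have hR : S.R = S.Q - S.C * S.Sig * S.C.transpose := by rw [Q]; abel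
  rw [hR, postCov]
  simp only [Matrix.transpose_sub, Matrix.transpose_mul, Matrix.transpose_one, Matrix.mul_sub,
    Matrix.sub_mul, hKQ]
  simp only [Matrix.mul_assoc, Matrix.one_mul, Matrix.mul_one]
  abel

lemma IsSteadyState.posSemidef_postCov {S : LTISystem n m p} (hS : S.IsSteadyState) :
    S.postCov.PosSemidef := by
  rw [hS.postCov_eq]
  refine Matrix.PosSemidef.add ?_ ?_
  · simpa only [Matrix.conjTranspose_eq_transpose_of_trivial] using
      hS.posSemidef_Sig.mul_mul_conjTranspose_same (1 - S.K * S.C)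
  · simpa using hS.posSemidef_R.mul_mul_conjTranspose_same S.K

/-- The value of the process noise `w k`. -/
abbrev processOf (ξ : (s : Source) → Vec (s.dim n p)) (k : ℕ) : Vec n := ξ (.process k)

/-- The value of the sensor noise `v (k + 1)`. -/
abbrev sensorOf (ξ : (s : Source) → Vec (s.dim n p)) (k : ℕ) : Vec p := ξ (.sensor k)

/-- The estimation error without attack as a function of the sources of randomness. -/
def sourceErr (ξ : (s : Source) → Vec (s.dim n p)) : ℕ → Vec n
  | 0 => ξ .init
  | k + 1 => act (1 - S.K * S.C) (act S.A (sourceErr ξ k) + processOf ξ k)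
      + act (-S.K) (sensorOf ξ k)

/-- The residue at time `k + 1` without attack as a function of the sources of randomness. -/
def innovation (ξ : (s : Source) → Vec (s.dim n p)) (k : ℕ) : Vec p :=
  act S.C (act S.A (S.sourceErr ξ k) + processOf ξ k) + sensorOf ξ k

/-- The contribution of the attack to the estimation error. -/
def attackErr (a : ℕ → Vec p) : ℕ → Vec n
  | 0 => 0
  | k + 1 => act (1 - S.K * S.C) (act S.A (attackErr a k)) + act (-S.K) (a (k + 1))

/-- The contribution of the attack to the residue at time `k + 1`. -/
def attackShift (a : ℕ → Vec p) (k : ℕ) : Vec p :=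
  act S.C (act S.A (S.attackErr a k)) + a (k + 1)

end LTISystem

/-- The values of all sources of randomness at one outcome. -/
def Source.values {n p : ℕ} {Ω : Type*} (x₀ xh₀ : Ω → Vec n) (w : ℕ → Ω → Vec n)
    (v : ℕ → Ω → Vec p) (ω : Ω) (s : Source) : Vec (s.dim n p) :=
  s.toFun x₀ xh₀ w v ω

/-- The time after which a source of randomness influences the estimation error. -/
def Source.time : Source → ℕ
  | .init => 0
  | .process k => k + 1
  | .sensor k => k + 1

instance : Countable Source := by
  have : Function.Injective (fun s : Source => match s with
    | .init => (none : Option (ℕ ⊕ ℕ))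
    | .process k => some (.inl k)
    | .sensor k => some (.inr k)) := by
    rintro (_ | _ | _) (_ | _ | _) h <;> simp_all
  exact this.countable

namespace LTISystem

variable {n m p : ℕ} (S : LTISystem n m p) {Ω : Type*}

/-- Plant and filter receive the same input, which therefore drops out; this is why inputs may
depend arbitrarily on the attack and the outcome. -/
lemma traj_sub (x₀ xh₀ : Ω → Vec n) (w : ℕ → Ω → Vec n) (v : ℕ → Ω → Vec p)
    (u : ℕ → Ω → Vec m) (a : ℕ → Vec p) (ω : Ω) (k : ℕ) :
    (S.traj (x₀ ω) (xh₀ ω) (fun j => u j ω) (fun j => w j ω) (fun j => v j ω) a k).1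
      - (S.traj (x₀ ω) (xh₀ ω) (fun j => u j ω) (fun j => w j ω) (fun j => v j ω) a k).2
    = S.sourceErr (Source.values x₀ xh₀ w v ω) k + S.attackErr a k := by
  induction k with
  | zero => simp [traj, sourceErr, attackErr, Source.values, Source.toFun]
  | succ k ih =>
    rw [sourceErr, attackErr]
    have h1 : processOf (Source.values x₀ xh₀ w v ω) k = w k ω := rfl
    have h2 : sensorOf (Source.values x₀ xh₀ w v ω) k = v (k + 1) ω := rfl
    rw [h1, h2]
    have h3 := congrArg (act S.A) ih
    simp only [map_sub, map_add] at h3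
    rw [sub_eq_iff_eq_add] at h3
    simp only [traj, act]
    rw [h3]
    simp only [act_sub_left, act_one, act_mul]
    simp only [map_sub, map_add, map_neg, LinearMap.neg_apply]
    abel

lemma residueRV_succ (x₀ xh₀ : Ω → Vec n) (w : ℕ → Ω → Vec n) (v : ℕ → Ω → Vec p)
    (u : ℕ → Ω → Vec m) (a : ℕ → Vec p) (k : ℕ) (ω : Ω) :
    S.residueRV x₀ xh₀ w v u a (k + 1) ω
      = S.innovation (Source.values x₀ xh₀ w v ω) k + S.attackShift a k := by
  have h1 : processOf (Source.values x₀ xh₀ w v ω) k = w k ω := rfl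
  have h2 : sensorOf (Source.values x₀ xh₀ w v ω) k = v (k + 1) ω := rfl
  have h3 := congrArg (act S.A) (S.traj_sub x₀ xh₀ w v u a ω k)
  simp only [map_sub, map_add] at h3
  rw [sub_eq_iff_eq_add] at h3
  rw [innovation, attackShift, h1, h2]
  simp only [residueRV, residue, Nat.add_sub_cancel, traj, act]
  rw [h3]
  simp only [map_add]
  abel

lemma attackErr_eq_zero {a : ℕ → Vec p} {k : ℕ} (ha : ∀ j ≤ k, a j = 0) : S.attackErr a k = 0 := by
  induction k with
  | zero => rfl
  | succ k ih =>
    rw [attackErr, ih fun j hj => ha j (hj.trans k.le_succ), ha _ le_rfl]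
    simp

lemma attackShift_of_forall_le {a : ℕ → Vec p} {k : ℕ} (ha : ∀ j ≤ k, a j = 0) :
    S.attackShift a k = a (k + 1) := by
  rw [attackShift, S.attackErr_eq_zero ha]
  simp

section Law

/-- The `σ`-algebra generated by the sources of randomness in a set. -/
abbrev sourceSigma {n p : ℕ} (Y : (s : Source) → Ω → Vec (s.dim n p)) (I : Set Source) :
    MeasurableSpace Ω :=
  ⨆ s ∈ I, MeasurableSpace.comap (Y s) inferInstance

lemma measurable_sourceSigma (Y : (s : Source) → Ω → Vec (s.dim n p)) {I : Set Source}
    {s : Source} (hs : s ∈ I) : Measurable[sourceSigma Y I] (Y s) :=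
  (comap_measurable (Y s)).mono
    (le_iSup₂ (f := fun s (_ : s ∈ I) => MeasurableSpace.comap (Y s) inferInstance) s hs) le_rfl

/-- Causality: it makes the error at time k independent of w_k and v_{k+1}. -/
lemma measurable_sourceErr (Y : (s : Source) → Ω → Vec (s.dim n p)) (k : ℕ) :
    Measurable[sourceSigma Y {s | s.time ≤ k}] (fun ω => S.sourceErr (fun s => Y s ω) k) := by
  induction k with
  | zero => exact measurable_sourceSigma Y (s := .init) (le_refl 0)
  | succ k ih =>
    have h1 : Measurable[sourceSigma Y {s | s.time ≤ k + 1}] (Y (.process k)) :=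
      measurable_sourceSigma Y (s := .process k) (le_refl (k + 1))
    have h2 : Measurable[sourceSigma Y {s | s.time ≤ k + 1}] (Y (.sensor k)) :=
      measurable_sourceSigma Y (s := .sensor k) (le_refl (k + 1))
    have h3 : Measurable[sourceSigma Y {s | s.time ≤ k + 1}]
        (fun ω => S.sourceErr (fun s => Y s ω) k) :=
      ih.mono (biSup_mono fun s hs => Nat.le_succ_of_le hs) le_rfl
    exact ((measurable_act _).comp (((measurable_act _).comp h3).add h1)).add
      ((measurable_act _).comp h2)

variable [MeasurableSpace Ω] {P : Measure Ω}
variable {Y : (s : Source) → Ω → Vec (s.dim n p)}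

lemma indepFun_of_measurable_sourceSigma (hYm : ∀ s, Measurable (Y s)) (hY : iIndepFun Y P)
    {I : Set Source} {s : Source} (hs : s ∉ I) {d : ℕ} {X : Ω → Vec d}
    (hX : Measurable[sourceSigma Y I] X) : IndepFun X (Y s) P := by
  have h := indep_iSup_of_disjoint (fun s => (hYm s).comap_le) hY
    (Set.disjoint_singleton_right.2 hs)
  rw [IndepFun_iff_Indep]
  refine indep_of_indep_of_le_left (indep_of_indep_of_le_right h ?_) hX.comap_le
  exact le_iSup₂ (f := fun t (_ : t ∈ ({s} : Set Source)) =>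
    MeasurableSpace.comap (Y t) inferInstance) s rfl

/-- The covariances of the sources of randomness. -/
def sourceCov : (s : Source) → Matrix (Fin (s.dim n p)) (Fin (s.dim n p)) ℝ
  | .init => S.postCov
  | .process _ => S.W
  | .sensor _ => S.R

lemma hasLaw_prediction (hS : S.IsSteadyState) (hYm : ∀ s, Measurable (Y s))
    (hY : iIndepFun Y P) (hlaw : ∀ s, HasLaw (Y s) (multivariateGaussian 0 (S.sourceCov s)) P)
    (k : ℕ) (he : HasLaw (fun ω => S.sourceErr (fun s => Y s ω) k)
      (multivariateGaussian 0 S.postCov) P) :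
    HasLaw (fun ω => act S.A (S.sourceErr (fun s => Y s ω) k) + processOf (fun s => Y s ω) k)
      (multivariateGaussian 0 S.Sig) P := by
  have hpc := hS.posSemidef_postCov
  have hind : IndepFun (fun ω => act S.A (S.sourceErr (fun s => Y s ω) k)) (Y (.process k)) P :=
    indepFun_of_measurable_sourceSigma hYm hY (by simp [Source.time])
      ((measurable_act _).comp (S.measurable_sourceErr Y k))
  have h1 : (S.A * S.postCov * S.A.transpose).PosSemidef := by
    simpa using hpc.mul_mul_conjTranspose_same S.A
  rw [hS.riccati]
  exact hasLaw_add h1 hS.posSemidef_W (hasLaw_act hpc he S.A) (hlaw (.process k)) hind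

lemma indepFun_prediction_sensor (hYm : ∀ s, Measurable (Y s)) (hY : iIndepFun Y P) (k : ℕ) :
    IndepFun (fun ω => act S.A (S.sourceErr (fun s => Y s ω) k) + processOf (fun s => Y s ω) k)
      (Y (.sensor k)) P := by
  refine indepFun_of_measurable_sourceSigma hYm hY
    (I := insert (.process k) {s | s.time ≤ k}) (s := .sensor k) (by simp [Source.time]) ?_
  have h1 : Measurable[sourceSigma Y (insert (.process k) {s | s.time ≤ k})] (Y (.process k)) :=
    measurable_sourceSigma Y (Set.mem_insert _ _)
  have h3 : Measurable[sourceSigma Y (insert (.process k) {s | s.time ≤ k})]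
      (fun ω => S.sourceErr (fun s => Y s ω) k) :=
    (S.measurable_sourceErr Y k).mono (biSup_mono fun s hs => Set.mem_insert_of_mem _ hs) le_rfl
  exact ((measurable_act _).comp h3).add h1

/-- Stationarity: the Riccati equation takes `postCov` to `Sig` in the prediction step, and the
Joseph form takes `Sig` back to `postCov` in the update. -/
lemma hasLaw_sourceErr (hS : S.IsSteadyState) (hYm : ∀ s, Measurable (Y s))
    (hY : iIndepFun Y P) (hlaw : ∀ s, HasLaw (Y s) (multivariateGaussian 0 (S.sourceCov s)) P)
    (k : ℕ) :
    HasLaw (fun ω => S.sourceErr (fun s => Y s ω) k) (multivariateGaussian 0 S.postCov) P := by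
  induction k with
  | zero => exact hlaw .init
  | succ k ih =>
    have h1 : ((1 - S.K * S.C : Matrix (Fin n) (Fin n) ℝ) * S.Sig *
        (1 - S.K * S.C).transpose).PosSemidef := by
      simpa only [Matrix.conjTranspose_eq_transpose_of_trivial] using
      hS.posSemidef_Sig.mul_mul_conjTranspose_same (1 - S.K * S.C)
    have h2 : (-S.K * S.R * (-S.K).transpose).PosSemidef := by
      simpa using hS.posSemidef_R.mul_mul_conjTranspose_same (-S.K)
    have hcov : S.postCov = (1 - S.K * S.C) * S.Sig * (1 - S.K * S.C).transpose
        + -S.K * S.R * (-S.K).transpose := by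
      rw [hS.postCov_eq, Matrix.transpose_neg, Matrix.mul_neg, Matrix.neg_mul, Matrix.neg_mul,
        neg_neg]
    rw [hcov]
    exact hasLaw_add h1 h2
      (hasLaw_act hS.posSemidef_Sig (S.hasLaw_prediction hS hYm hY hlaw k ih) _)
      (hasLaw_act hS.posSemidef_R (hlaw (.sensor k)) _)
      ((S.indepFun_prediction_sensor hYm hY k).comp (measurable_act _) (measurable_act _))

lemma hasLaw_innovation_of_measurable (hS : S.IsSteadyState) (hYm : ∀ s, Measurable (Y s))
    (hY : iIndepFun Y P) (hlaw : ∀ s, HasLaw (Y s) (multivariateGaussian 0 (S.sourceCov s)) P)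
    (k : ℕ) :
    HasLaw (fun ω => S.innovation (fun s => Y s ω) k) (multivariateGaussian 0 S.Q) P := by
  have h1 : (S.C * S.Sig * S.C.transpose).PosSemidef := by
    simpa using hS.posSemidef_Sig.mul_mul_conjTranspose_same S.C
  exact hasLaw_add h1 hS.posSemidef_R
    (hasLaw_act hS.posSemidef_Sig
      (S.hasLaw_prediction hS hYm hY hlaw k (S.hasLaw_sourceErr hS hYm hY hlaw k)) _)
    (hlaw (.sensor k))
    ((S.indepFun_prediction_sensor hYm hY k).comp (measurable_act _) measurable_id)

/-- The residue without attack is a centred Gaussian vector with covariance `Q`. -/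
lemma hasLaw_innovation (hS : S.IsSteadyState) {x₀ xh₀ : Ω → Vec n} {w : ℕ → Ω → Vec n}
    {v : ℕ → Ω → Vec p} (hM : IsGaussianModel S P x₀ xh₀ w v) (k : ℕ) :
    HasLaw (fun ω => S.innovation (Source.values x₀ xh₀ w v ω) k)
      (multivariateGaussian 0 S.Q) P := by
  have hlaw : ∀ s : Source,
      HasLaw (s.toFun x₀ xh₀ w v) (multivariateGaussian 0 (S.sourceCov s)) P := by
    rintro (_ | k | k)
    · exact hM.law_init
    · exact hM.law_process k
    · exact hM.law_sensor k
  -- The sources are only a.e. measurable; measurable versions are needed for the generated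
  -- σ-algebras to lie in the ambient one.
  set Y : (s : Source) → Ω → Vec (s.dim n p) := fun s => (hlaw s).aemeasurable.mk _ with hYdef
  have hae : ∀ s : Source, s.toFun x₀ xh₀ w v =ᵐ[P] Y s := fun s => (hlaw s).aemeasurable.ae_eq_mk
  refine (S.hasLaw_innovation_of_measurable hS (fun s => (hlaw s).aemeasurable.measurable_mk)
    (hM.indep.congr hae) (fun s => (hlaw s).congr (hae s).symm) k).congr ?_
  filter_upwards [ae_all_iff.2 hae] with ω hω
  exact congrArg (fun ξ => S.innovation ξ k) (funext hω)

end Law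

end LTISystem

end StealthyAttack

end

noncomputable section

namespace StealthyAttack

/-! ### Whitening and the alarm probability. -/

namespace LTISystem

variable {n m p : ℕ} (S : LTISystem n m p)

/-- The whitening matrix `Q^{-1/2}`. -/
abbrev whitening : Matrix (Fin p) (Fin p) ℝ := CFC.sqrt S.Q⁻¹

variable {S}

lemma transpose_whitening : S.whitening.transpose = S.whitening := by
  simpa only [Matrix.conjTranspose_eq_transpose_of_trivial] using
    (Matrix.nonneg_iff_posSemidef.1 (CFC.sqrt_nonneg S.Q⁻¹)).isHermitian.eq

lemma IsSteadyState.whitening_mul_self (hS : S.IsSteadyState) :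
    S.whitening * S.whitening = S.Q⁻¹ :=
  CFC.sqrt_mul_sqrt_self _ hS.posDef_Q.inv.posSemidef.nonneg

lemma IsSteadyState.whitening_mul_whitening_mul (hS : S.IsSteadyState) :
    S.whitening * (S.whitening * S.Q) = 1 := by
  rw [← Matrix.mul_assoc, hS.whitening_mul_self,
    Matrix.nonsing_inv_mul _ hS.posDef_Q.det_pos.ne'.isUnit]

lemma IsSteadyState.whitening_mul_mul_whitening (hS : S.IsSteadyState) :
    S.whitening * S.Q * S.whitening = 1 :=
  mul_eq_one_comm.1 hS.whitening_mul_whitening_mul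

lemma IsSteadyState.detector_eq (hS : S.IsSteadyState) (z : Vec p) :
    S.detector z = ‖act S.whitening z‖ ^ 2 := by
  rw [← real_inner_self_eq_norm_sq, inner_act, transpose_whitening, ← act_mul,
    hS.whitening_mul_self, detector, EuclideanSpace.inner_eq_star_dotProduct, dotProduct_comm]
  simp [act]

lemma IsSteadyState.act_whitening_ne_zero (hS : S.IsSteadyState) {z : Vec p} (hz : z ≠ 0) :
    act S.whitening z ≠ 0 := by
  intro h
  have h1 := congrArg (act (S.whitening * S.Q)) h
  rw [← act_mul, hS.whitening_mul_mul_whitening, act_one, act_zero] at h1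
  exact hz h1

variable {Ω : Type*} [MeasurableSpace Ω] {P : Measure Ω} {x₀ xh₀ : Ω → Vec n}
  {w : ℕ → Ω → Vec n} {v : ℕ → Ω → Vec p}

lemma alarmProb_eq (hS : S.IsSteadyState) (hM : IsGaussianModel S P x₀ xh₀ w v)
    (u : ℕ → Ω → Vec m) (a : ℕ → Vec p) (h : ℝ) (k : ℕ) :
    S.alarmProb P h (S.residueRV x₀ xh₀ w v u a (k + 1))
      = noncentralTail h (act S.whitening (S.attackShift a k)) := by
  have hlaw := hasLaw_act hS.posDef_Q.posSemidef (S.hasLaw_innovation hS hM k) S.whitening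
  rw [transpose_whitening, hS.whitening_mul_mul_whitening, multivariateGaussian_zero_one] at hlaw
  rw [noncentralTail, ← hlaw.measureReal_eq (measurableSet_lt_norm_add_sq h _), alarmProb]
  simp only [residueRV_succ, hS.detector_eq, map_add]

lemma attackShift_zero (k : ℕ) : S.attackShift 0 k = 0 :=
  S.attackShift_of_forall_le fun _ _ => rfl

/-- In terms of the tail function, stealthiness is a condition on the whitened shift. -/
lemma stealthIffBound_iff [IsProbabilityMeasure P] (hS : S.IsSteadyState)
    (hM : IsGaussianModel S P x₀ xh₀ w v)
    (u : ℕ → Ω → Vec m) (ua : (ℕ → Vec p) → ℕ → Ω → Vec m) (𝒦 : Finset (Fin p)) (h ε : ℝ) (k : ℕ)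
    (α : ℝ) :
    StealthIffBound S P x₀ xh₀ w v u ua 𝒦 h ε (k + 1) α ↔
      ∀ a : ℕ → Vec p, IsAttack 𝒦 a →
        (noncentralTail h (act S.whitening (S.attackShift a k)) ≤
          noncentralTail h (0 : Vec p) + ε ↔ ‖act S.whitening (S.attackShift a k)‖ ≤ α) := by
  have : Nonempty Ω := P.nonempty_of_neZero
  simp only [StealthIffBound, alarmProb_eq hS hM, attackShift_zero, map_zero, residueRV_succ,
    add_zero, add_sub_cancel_left, invNorm, forall_const]

/-- An attack that acts at a single time reaches every norm of the whitened shift. -/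
lemma exists_attack_norm_eq (hS : S.IsSteadyState) {𝒦 : Finset (Fin p)} (h𝒦 : 𝒦.Nonempty) (k : ℕ)
    {r : ℝ} (hr : 0 ≤ r) :
    ∃ a : ℕ → Vec p, IsAttack 𝒦 a ∧ ‖act S.whitening (S.attackShift a k)‖ = r := by
  obtain ⟨i, hi⟩ := h𝒦
  set b : Vec p := EuclideanSpace.single i 1 with hb
  have hb0 : b ≠ 0 := by
    intro h0
    simpa [hb] using congrArg norm h0
  have hTb : 0 < ‖act S.whitening b‖ := norm_pos_iff.2 (hS.act_whitening_ne_zero hb0)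
  refine ⟨Function.update 0 (k + 1) ((r / ‖act S.whitening b‖) • b), ⟨by simp, fun j l hl => ?_⟩, ?_⟩
  · have hli : l ≠ i := fun h0 => hl (h0 ▸ hi)
    by_cases hj : j = k + 1
    · subst hj
      simp [hb, hli]
    · simp [hj]
  · rw [S.attackShift_of_forall_le fun j hj => by simp [(Nat.lt_succ_of_le hj).ne],
      Function.update_self, act_smul, norm_smul, Real.norm_of_nonneg (by positivity),
      div_mul_cancel₀ _ hTb.ne']

end LTISystem

end StealthyAttack

end

theorem mainTheorem6 :
    ∃ αχ : ℝ → ℕ → ℝ → ℝ,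
      ∀ (n m p : ℕ) (S : StealthyAttack.LTISystem n m p) (_ : S.IsSteadyState)
        (Ω : Type*) [MeasurableSpace Ω] (P : MeasureTheory.Measure Ω)
        [MeasureTheory.IsProbabilityMeasure P]
        (x₀ xh₀ : Ω → StealthyAttack.Vec n) (w : ℕ → Ω → StealthyAttack.Vec n)
        (v : ℕ → Ω → StealthyAttack.Vec p)
        (_ : StealthyAttack.IsGaussianModel S P x₀ xh₀ w v)
        (u : ℕ → Ω → StealthyAttack.Vec m)
        (ua : (ℕ → StealthyAttack.Vec p) → ℕ → Ω → StealthyAttack.Vec m)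
        (𝒦 : Finset (Fin p)) (_ : 𝒦.Nonempty) (h ε : ℝ) (k : ℕ),
        0 < ε → 1 ≤ k →
        (ε < 1 - S.alarmProb P h (S.residueRV x₀ xh₀ w v u 0 k) →
          (∃! α : ℝ, 0 < α ∧ StealthyAttack.StealthIffBound S P x₀ xh₀ w v u ua 𝒦 h ε k α) ∧
          0 < αχ ε p h ∧
          StealthyAttack.StealthIffBound S P x₀ xh₀ w v u ua 𝒦 h ε k (αχ ε p h)) ∧
        (ε = 1 - S.alarmProb P h (S.residueRV x₀ xh₀ w v u 0 k) →
          ∀ a, StealthyAttack.IsAttack 𝒦 a →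
            S.alarmProb P h (S.residueRV x₀ xh₀ w v (ua a) a k)
              ≤ S.alarmProb P h (S.residueRV x₀ xh₀ w v u 0 k) + ε) := by
  open StealthyAttack LTISystem in
  refine ⟨fun ε p h => noncentralRadius (Vec p) ε h, ?_⟩
  intro n m p S hS Ω _ P _ x₀ xh₀ w v hM u ua 𝒦 h𝒦 h ε k hε hk
  obtain ⟨k, rfl⟩ := Nat.exists_eq_add_of_le' hk
  refine ⟨fun hlt => ?_, fun heq a _ => ?_⟩
  -- A compromised sensor forces p ≥ 1, so `Vec p` is nontrivial.
  · have : Nonempty (Fin p) := ⟨h𝒦.choose⟩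
    rw [alarmProb_eq hS hM, attackShift_zero, act_zero] at hlt
    have hpos := noncentralRadius_pos hε hlt
    have hbound : StealthIffBound S P x₀ xh₀ w v u ua 𝒦 h ε (k + 1)
        (noncentralRadius (Vec p) ε h) :=
      (stealthIffBound_iff hS hM u ua 𝒦 h ε k _).2 fun a _ => noncentralTail_le_iff hε hlt _
    refine ⟨⟨_, ⟨hpos, hbound⟩, fun α ⟨hα, hαb⟩ => ?_⟩, hpos, hbound⟩
    rw [stealthIffBound_iff hS hM] at hαb hbound
    -- All r ≥ 0 are attained norms, so the two thresholds can be tested against each other.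
    have hiff : ∀ r : ℝ, 0 ≤ r → (r ≤ α ↔ r ≤ noncentralRadius (Vec p) ε h) := by
      intro r hr
      obtain ⟨a, ha, rfl⟩ := exists_attack_norm_eq hS h𝒦 k hr
      exact (hαb a ha).symm.trans (hbound a ha)
    exact le_antisymm ((hiff α hα.le).1 le_rfl) ((hiff _ hpos.le).2 le_rfl)
  · rw [heq, add_sub_cancel]
    exact measureReal_le_one
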